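/- Let $G$ be a group isomorphic to the symmetric group $S_6$, and suppose that $G=\langle a,b,c\rangle$ is a triangle-point group; that is, $a,b,c$ generate $G$, the elements $a,b,c,ab$ have order $2$, and $ts$ has order at most $6$ for all $t,s\in a^G\cup b^G\cup c^G\cup (ab)^G$. Let $T\subseteq G$ be a subset with $a,b,c,ab\in T$. Then there exists no Majorana representation of the form $(G,T,V)$. Here a Majorana representation $(G,T,V)$ consists of the following data. $G$ is a finite group and $T$ is a set of elements of order $2$ that is closed under conjugation and generates $G$. $V$ is a real vector space with a (positive definite) inner product $(\,,)$ and a commutative, bilinear, not necessarily associative product $\cdot$ such that (M1) $(u,v\cdot w)=(u\cdot v,w)$ for all $u,v,w\in V$; (M2) $(u\cdot u,v\cdot v)\ge(u\cdot v,u\cdot v)$ for all $u,v\in V$, and $V$ is generated as an algebra by a set $A\subset V\setminus\{0\}$ of Majorana axes: writing $V_\mu^{(a)}=\{v\in V: a\cdot v=\mu v\}$, every $a\in A$ satisfies (M3) $(a,a)=1$ and $a\cdot a=a$; (M4) $V=V_1^{(a)}\oplus V_0^{(a)}\oplus V_{1/4}^{(a)}\oplus V_{1/32}^{(a)}$; (M5)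 $V_1^{(a)}=\mathbb{R}a$; (M6) the linear map $\tau(a)$ of $V$ that is the identity on $V_1^{(a)}\oplus V_0^{(a)}\oplus V_{1/4}^{(a)}$ and $-1$ on $V_{1/32}^{(a)}$ preserves the product; (M7) the linear map $\sigma(a)$ of $V_+^{(a)}=V_1^{(a)}\oplus V_0^{(a)}\oplus V_{1/4}^{(a)}$ that is the identity on $V_1^{(a)}\oplus V_0^{(a)}$ and $-1$ on $V_{1/4}^{(a)}$ preserves the restriction of the product to $V_+^{(a)}$. Moreover, there are a linear representation $\varphi:G\to GL(V)$ preserving both the product and the inner product, and a bijection $\psi:T\to A$ with $\psi(t^g)=\psi(t)^{\varphi(g)}$ for all $t\in T$, $g\in G$, such that (M8) for $t_0,t_1\in T$, if $\psi(t_0)$ and $\psi(t_1)$ generate a dihedral algebra of type $2A$ with third basis vector $a_\rho$, then $t_0t_1\in T$ and $\psi(t_0t_1)=a_\rho$; and if $t_0,t_1,t_2\in T$ satisfy $t_0t_1t_2=1$, then $\psi(t_0)$ and $\psi(t_1)$ generate a dihedral algebra of type $2A$ with $a_\rho=\psi(t_2)$. Vectors $a_0,a_1$ generate a dihedral algebra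 of type $2A$ with third basis vector $a_\rho$ if the subalgebra generated by $a_0,a_1$ has basis $a_0,a_1,a_\rho$, these three vectors are idempotents of length $1$, any two of them have inner product $\tfrac18$, and $x\cdot y=\tfrac18(x+y-z)$ whenever $\{x,y,z\}=\{a_0,a_1,a_\rho\}$. -/

import Mathlib

/-- `G` is a triangle-point group with respect to the generators `a`, `b`, `c`: the elements
`a, b, c, ab` have order `2`, `a, b, c` generate `G`, and the product of any two elements of
`a^G ∪ b^G ∪ c^G ∪ (ab)^G` has (finite) order at most `6`. -/
structure IsTrianglePoint {G : Type*} [Group G] (a b c : G) : Prop where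
  orderOf_a : orderOf a = 2
  orderOf_b : orderOf b = 2
  orderOf_c : orderOf c = 2
  orderOf_ab : orderOf (a * b) = 2
  generate : Subgroup.closure {a, b, c} = ⊤
  order_le : ∀ t ∈ conjugatesOf a ∪ conjugatesOf b ∪ conjugatesOf c ∪ conjugatesOf (a * b),
    ∀ s ∈ conjugatesOf a ∪ conjugatesOf b ∪ conjugatesOf c ∪ conjugatesOf (a * b),
      IsOfFinOrder (t * s) ∧ orderOf (t * s) ≤ 6

namespace Majorana

variable {V : Type*} [NonUnitalNonAssocCommRing V] [Module ℝ V]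
  [IsScalarTower ℝ V V] [SMulCommClass ℝ V V]

/-- The space `{v | a * v = μ • v}` of `μ`-eigenvectors of the adjoint action of `a` on `V`. -/
noncomputable def eigen (a : V) (μ : ℝ) : Submodule ℝ V :=
  Module.End.eigenspace (LinearMap.mulLeft ℝ a) μ

/-- The sum of the eigenspaces of `a` for the eigenvalues `1`, `0` and `1/4`. -/
noncomputable def plusPart (a : V) : Submodule ℝ V :=
  eigen a 1 ⊔ eigen a 0 ⊔ eigen a (1 / 4)

/-- `τ` is the linear map acting as `(-1) ^ (2 ^ 5 * μ)` on the `μ`-eigenspace of `a`, for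
`μ = 1, 0, 1/4, 1/32`. -/
structure IsTau (a : V) (τ : V →ₗ[ℝ] V) : Prop where
  one : ∀ u ∈ eigen a 1, τ u = u
  zero : ∀ u ∈ eigen a 0, τ u = u
  quarter : ∀ u ∈ eigen a (1 / 4), τ u = u
  thirtysecond : ∀ u ∈ eigen a (1 / 32), τ u = -u

/-- `σ` is the linear map of `plusPart a` acting as `(-1) ^ (2 ^ 2 * μ)` on the `μ`-eigenspace
of `a`, for `μ = 1, 0, 1/4`. -/
structure IsSigma (a : V) (σ : plusPart a →ₗ[ℝ] plusPart a) : Prop where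
  one : ∀ u : plusPart a, (u : V) ∈ eigen a 1 → σ u = u
  zero : ∀ u : plusPart a, (u : V) ∈ eigen a 0 → σ u = u
  quarter : ∀ u : plusPart a, (u : V) ∈ eigen a (1 / 4) → σ u = -u

/-- `B` is an inner product on the commutative algebra `V` that satisfies the axioms (M1) (it
associates with the product) and (M2) (the Norton inequality). -/
structure IsMajoranaForm (B : LinearMap.BilinForm ℝ V) : Prop where
  symm : ∀ u v, B u v = B v u
  posDef : ∀ u, u ≠ 0 → 0 < B u u
  /-- (M1) -/
  assoc : ∀ u v w, B u (v * w) = B (u * v) w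
  /-- (M2) -/
  norton : ∀ u v, B (u * v) (u * v) ≤ B (u * u) (v * v)

/-- `a` is a Majorana axis: the axioms (M3) to (M7). By the decomposition `decomp` the maps `τ`
and `σ` exist and are unique, so that the last two axioms say that these maps preserve the
product of `V` and its restriction to `plusPart a`. -/
structure IsAxis (B : LinearMap.BilinForm ℝ V) (a : V) : Prop where
  /-- (M3), the length -/
  length : B a a = 1
  /-- (M3), idempotency -/
  idem : a * a = a
  /-- (M4) -/
  decomp : DirectSum.IsInternal
    (fun i : Fin 4 => eigen a ((![1, 0, 1 / 4, 1 / 32] : Fin 4 → ℝ) i))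
  /-- (M5) -/
  primitive : eigen a 1 = Submodule.span ℝ {a}
  /-- (M6) -/
  tau : ∃ τ : V →ₗ[ℝ] V, IsTau a τ ∧ ∀ u v, τ (u * v) = τ u * τ v
  /-- (M7) -/
  sigma : ∃ σ : plusPart a →ₗ[ℝ] plusPart a, IsSigma a σ ∧
    ∀ u v : plusPart a, ∃ h : (u : V) * (v : V) ∈ plusPart a,
      (σ ⟨(u : V) * (v : V), h⟩ : V) = (σ u : V) * (σ v : V)

/-- The axes `a₀` and `a₁` generate a dihedral algebra of type `2A`, whose third basis vector
`a_ρ` is `aρ`. -/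
structure IsType2A (B : LinearMap.BilinForm ℝ V) (a₀ a₁ aρ : V) : Prop where
  linearIndependent : LinearIndependent ℝ ![a₀, a₁, aρ]
  adjoin_eq : (NonUnitalAlgebra.adjoin ℝ {a₀, a₁}).toSubmodule = Submodule.span ℝ {a₀, a₁, aρ}
  idem₀ : a₀ * a₀ = a₀
  idem₁ : a₁ * a₁ = a₁
  idemρ : aρ * aρ = aρ
  mul₀₁ : a₀ * a₁ = (1 / 8 : ℝ) • (a₀ + a₁ - aρ)
  mul₀ρ : a₀ * aρ = (1 / 8 : ℝ) • (a₀ + aρ - a₁)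
  mul₁ρ : a₁ * aρ = (1 / 8 : ℝ) • (a₁ + aρ - a₀)
  form₀₀ : B a₀ a₀ = 1
  form₁₁ : B a₁ a₁ = 1
  formρρ : B aρ aρ = 1
  form₀₁ : B a₀ a₁ = 1 / 8
  form₀ρ : B a₀ aρ = 1 / 8
  form₁ρ : B a₁ aρ = 1 / 8

end Majorana

/-- A Majorana representation `(G, T, V, ·, ( , ), φ, ψ)`, including axiom (M8). The product of
`V` is that of the algebra structure on `V`. Linear maps are written on the left here, so that
the compatibility `ψ(t ^ g) = ψ(t) ^ φ(g)` of right actions becomes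
`ψ (g * t * g⁻¹) = φ g (ψ t)`. -/
structure MajoranaRepresentation (G : Type*) [Group G] (T : Set G)
    (V : Type*) [NonUnitalNonAssocCommRing V] [Module ℝ V]
    [IsScalarTower ℝ V V] [SMulCommClass ℝ V V] where
  finite : Finite G
  involution : ∀ t ∈ T, orderOf t = 2
  conj_mem : ∀ (g : G), ∀ t ∈ T, g * t * g⁻¹ ∈ T
  closure_eq : Subgroup.closure T = ⊤
  /-- the inner product -/
  form : LinearMap.BilinForm ℝ V
  isMajoranaForm : Majorana.IsMajoranaForm form
  /-- the generating set `A` of Majorana axes -/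
  axes : Set V
  isAxis : ∀ a ∈ axes, Majorana.IsAxis form a
  adjoin_axes : NonUnitalAlgebra.adjoin ℝ axes = ⊤
  φ : Representation ℝ G V
  φ_mul : ∀ g u v, φ g (u * v) = φ g u * φ g v
  φ_form : ∀ g u v, form (φ g u) (φ g v) = form u v
  ψ : T ≃ axes
  ψ_conj : ∀ (g : G) (t : T), (ψ ⟨g * t * g⁻¹, conj_mem g t t.2⟩ : V) = φ g (ψ t)
  /-- (M8), first part -/
  mem_of_type2A : ∀ (t₀ t₁ : T) (aρ : V), Majorana.IsType2A form (ψ t₀ : V) (ψ t₁ : V) aρ →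
    ∃ h : (t₀ * t₁ : G) ∈ T, (ψ ⟨t₀ * t₁, h⟩ : V) = aρ
  /-- (M8), second part -/
  type2A_of_mul_eq_one : ∀ t₀ t₁ t₂ : T, (t₀ * t₁ * t₂ : G) = 1 →
    Majorana.IsType2A form (ψ t₀ : V) (ψ t₁ : V) (ψ t₂ : V)

/-! Two facts collide. First, `T` cannot contain all nonidentity elements of an elementary abelian
group `⟨t, s, r⟩` of order 8. There the map `σ` of `ψ t` interchanges `ψ s` with `ψ (ts)`, `ψ r`
with `ψ (tr)` and `ψ (sr)` with `ψ (tsr)`. Applied to the `2A` product of `ψ s` and `ψ r`, it gives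
a formula for `ψ (ts) * ψ (tr)` that ends in `ψ (tsr)`. But `(ts)(tr) = sr`, so the `2A` formula for
this pair ends in `ψ (sr)`. Injectivity of `ψ` then forces `t = 1`
(`MajoranaRepresentation.false_of_commute`).

Second, `a, b, c, ab` meet all three classes of involutions of `S₆` (`exists_card_support_eq`), so
`T` contains every involution, in particular those of `⟨(01), (23), (45)⟩`. A missing even class
contradicts multiplicativity of the sign. A missing odd class is excluded by counting fixed points
in the transitive action on the 15 involutions of the other odd class
(`card_fixed_le_of_transitive`). -/

namespace Majorana

variable {V : Type*} [NonUnitalNonAssocCommRing V] [Module ℝ V]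
  [SMulCommClass ℝ V V]

/-! ### Dihedral algebras of type 2A and the map σ -/

lemma mem_eigen {a v : V} {μ : ℝ} : v ∈ eigen a μ ↔ a * v = μ • v := by
  simp [eigen]

lemma eigen_le_plusPart (a : V) :
    eigen a 1 ≤ plusPart a ∧ eigen a 0 ≤ plusPart a ∧ eigen a (1 / 4) ≤ plusPart a :=
  ⟨le_sup_left.trans le_sup_left, le_sup_right.trans le_sup_left, le_sup_right⟩

variable [IsScalarTower ℝ V V] {B : LinearMap.BilinForm ℝ V} {x y z : V}

lemma IsType2A.sub_mem_eigen (h : IsType2A B x y z) : y - z ∈ eigen x (1 / 4) := by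
  rw [mem_eigen, mul_sub, h.mul₀₁, h.mul₀ρ]
  module

lemma IsType2A.add_sub_mem_eigen (h : IsType2A B x y z) :
    y + z - (1 / 4 : ℝ) • x ∈ eigen x 0 := by
  rw [mem_eigen, mul_sub, mul_add, h.mul₀₁, h.mul₀ρ, mul_smul_comm, h.idem₀]
  module

lemma IsType2A.self_mem_eigen (h : IsType2A B x y z) : x ∈ eigen x 1 := by
  rw [mem_eigen, h.idem₀, one_smul]

/-- The map `σ` of `x` interchanges the other two axes of a dihedral algebra of type `2A`. -/
lemma IsType2A.exists_sigma_eq (h : IsType2A B x y z) {σ : plusPart x →ₗ[ℝ] plusPart x}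
    (hσ : IsSigma x σ) : ∃ hy : y ∈ plusPart x, (σ ⟨y, hy⟩ : V) = z := by
  obtain ⟨h1, h0, h4⟩ := eigen_le_plusPart x
  let u₁ : plusPart x := ⟨x, h1 h.self_mem_eigen⟩
  let u₀ : plusPart x := ⟨_, h0 h.add_sub_mem_eigen⟩
  let u₄ : plusPart x := ⟨_, h4 h.sub_mem_eigen⟩
  -- Eigenvector decomposition of `y`; changing the sign of its `1/4`-part gives `z`.
  have hy : ((1 / 8 : ℝ) • u₁ + (1 / 2 : ℝ) • u₀ + (1 / 2 : ℝ) • u₄ : V) = y := by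
    simp only [u₁, u₀, u₄]
    module
  have hy' : y ∈ plusPart x := hy ▸
    ((1 / 8 : ℝ) • u₁ + (1 / 2 : ℝ) • u₀ + (1 / 2 : ℝ) • u₄ : plusPart x).2
  have e : (⟨y, hy'⟩ : plusPart x) = (1 / 8 : ℝ) • u₁ + (1 / 2 : ℝ) • u₀ + (1 / 2 : ℝ) • u₄ :=
    Subtype.ext hy.symm
  refine ⟨hy', ?_⟩
  rw [e, map_add, map_add, map_smul, map_smul, map_smul, hσ.one u₁ h.self_mem_eigen,
    hσ.zero u₀ h.add_sub_mem_eigen, hσ.quarter u₄ h.sub_mem_eigen]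
  simp only [u₁, u₀, u₄, Submodule.coe_add, Submodule.coe_smul, Submodule.coe_neg]
  module

/-- If the axes `y₁`, `y₂`, `y₃` of a dihedral algebra of type `2A` are interchanged with `z₁`,
`z₂`, `z₃` by the map `σ` of an axis `x`, then `z₁ * z₂` is given by the `2A` formula as well. -/
lemma IsAxis.mul_of_isType2A (hx : IsAxis B x) {y₁ y₂ y₃ z₁ z₂ z₃ : V}
    (h₁ : IsType2A B x y₁ z₁) (h₂ : IsType2A B x y₂ z₂) (h₃ : IsType2A B x y₃ z₃)
    (h : IsType2A B y₁ y₂ y₃) : z₁ * z₂ = (1 / 8 : ℝ) • (z₁ + z₂ - z₃) := by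
  obtain ⟨σ, hσ, hmul⟩ := hx.sigma
  obtain ⟨m₁, e₁⟩ := h₁.exists_sigma_eq hσ
  obtain ⟨m₂, e₂⟩ := h₂.exists_sigma_eq hσ
  obtain ⟨m₃, e₃⟩ := h₃.exists_sigma_eq hσ
  obtain ⟨m, e⟩ := hmul ⟨y₁, m₁⟩ ⟨y₂, m₂⟩
  have : (⟨y₁ * y₂, m⟩ : plusPart x) =
      (1 / 8 : ℝ) • (⟨y₁, m₁⟩ + ⟨y₂, m₂⟩ - ⟨y₃, m₃⟩) := Subtype.ext h.mul₀₁
  rw [← e₁, ← e₂, ← e₃, ← e, this, map_smul, map_sub, map_add]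
  rfl

end Majorana

/-- The set `T` of a Majorana representation contains no elementary abelian group of order `8`
with the identity removed. -/
lemma MajoranaRepresentation.false_of_commute {G : Type*} [Group G] {T : Set G} {V : Type*}
    [NonUnitalNonAssocCommRing V] [Module ℝ V] [IsScalarTower ℝ V V] [SMulCommClass ℝ V V]
    (R : MajoranaRepresentation G T V) {t s r : G} (hts : Commute t s) (ht : t ∈ T) (hs : s ∈ T) (hr : r ∈ T) (hts' : t * s ∈ T)
    (htr' : t * r ∈ T) (hsr' : s * r ∈ T) (htsr : t * (s * r) ∈ T) : False := by
  have sq : ∀ x ∈ T, x * x = 1 := fun x hx => by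
    rw [← sq, ← R.involution x hx, pow_orderOf_eq_one]
  have key : ∀ (x y : G) (hx : x ∈ T) (hy : y ∈ T) (hxy : x * y ∈ T),
      Majorana.IsType2A R.form (R.ψ ⟨x, hx⟩ : V) (R.ψ ⟨y, hy⟩ : V) (R.ψ ⟨x * y, hxy⟩ : V) :=
    fun x y hx hy hxy => R.type2A_of_mul_eq_one _ _ _ (sq _ hxy)
  have e : t * s * (t * r) = s * r := by
    rw [hts.eq, mul_assoc, ← mul_assoc t t r, sq t ht, one_mul]
  have h := (R.isAxis _ (R.ψ ⟨t, ht⟩).2).mul_of_isType2A (key t s ht hs hts') (key t r ht hr htr')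
    (key t (s * r) ht hsr' htsr) (key s r hs hr hsr')
  -- The same product as in `h`, now from (M8) for `ts` and `tr`; only the third axis differs.
  have h' := (key (t * s) (t * r) hts' htr' (e ▸ hsr')).mul₀₁
  rw [h] at h'
  have h'' := sub_right_injective (smul_right_injective V (by norm_num : (1 / 8 : ℝ) ≠ 0) h')
  have h3 := congrArg Subtype.val (R.ψ.injective (Subtype.ext h''))
  simp only [e, mul_eq_right] at h3
  have := R.involution t ht
  simp [h3] at this

/-! ### A fixed-point bound for transitive groups -/

section Involutions

open Equiv

lemma trace_funLeft_perm {X : Type*} [Fintype X] [DecidableEq X] (σ : Perm X) :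
    LinearMap.trace ℚ (X → ℚ) (LinearMap.funLeft ℚ ℚ σ) =
      (Finset.univ.filter fun x => σ x = x).card := by
  rw [LinearMap.trace_eq_matrix_trace ℚ (Pi.basisFun ℚ X), Matrix.trace, Finset.card_filter]
  push_cast
  refine Finset.sum_congr rfl fun x _ => ?_
  simp [LinearMap.funLeft_apply, Pi.single_apply]

/-- Let `a` and `b` be commuting involutions and `c` an involution that together generate a
transitive permutation group. As `c` merges at most as many pairs of orbits of `⟨a, b⟩` as it has
nontrivial cycles, the group `⟨a, b⟩` cannot have too many orbits. -/
lemma card_fixed_le_of_transitive {X : Type*} [Fintype X] [DecidableEq X] {a b c : Perm X}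
    (ha : a * a = 1) (hb : b * b = 1) (hc : c * c = 1) (hab : Commute a b)
    (htrans : ∀ x y, ∃ g ∈ Subgroup.closure {a, b, c}, g x = y) :
    (Finset.univ.filter fun x => a x = x).card + (Finset.univ.filter fun x => b x = x).card +
      (Finset.univ.filter fun x => (a * b) x = x).card +
      2 * (Finset.univ.filter fun x => c x = x).card ≤ Fintype.card X + 4 := by
  set L : Perm X → Module.End ℚ (X → ℚ) := fun σ => LinearMap.funLeft ℚ ℚ σ with hL
  have Lmul : ∀ σ τ, L σ * L τ = L (τ * σ) := fun σ τ => rfl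
  have Lone : L 1 = 1 := rfl
  have La : L a * L a = 1 := by rw [Lmul, ha, Lone]
  have Lb : L b * L b = 1 := by rw [Lmul, hb, Lone]
  have Lc : L c * L c = 1 := by rw [Lmul, hc, Lone]
  have Lab : L a * L b = L b * L a := by rw [Lmul, Lmul, hab.eq]
  have trL : ∀ σ, LinearMap.trace ℚ (X → ℚ) (L σ) =
      (Finset.univ.filter fun x => σ x = x).card := trace_funLeft_perm
  have tr1 : LinearMap.trace ℚ (X → ℚ) 1 = Fintype.card X := by
    rw [LinearMap.trace_one, Module.finrank_fintype_fun_eq_card]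
  -- `p` averages over `⟨a, b⟩`, so its rank (its trace) is the number of orbits; the rank of `q` is
  -- the number of 2-cycles of `c`.
  set p : Module.End ℚ (X → ℚ) := (1 / 4 : ℚ) • (1 + L a + L b + L (a * b)) with hp
  set q : Module.End ℚ (X → ℚ) := (1 / 2 : ℚ) • (1 - L c) with hq
  have hp' : p = (1 / 4 : ℚ) • ((1 + L a) * (1 + L b)) := by
    rw [hp, ← Lmul, ← Lab]; congr 1; noncomm_ring
  have ap : L a * p = p := by
    have : L a * ((1 + L a) * (1 + L b)) = (1 + L a) * (1 + L b) := by
      rw [← mul_assoc, mul_add (L a), La, mul_one, add_comm (L a)]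
    rw [hp', mul_smul_comm, this]
  have bp : L b * p = p := by
    have : L b * ((1 + L a) * (1 + L b)) = (1 + L a) * (1 + L b) := by
      have h : (1 + L a) * (1 + L b) = (1 + L b) * (1 + L a) := by
        simp only [mul_add, add_mul, mul_one, one_mul, Lab]; abel
      rw [h, ← mul_assoc, mul_add (L b), Lb, mul_one, add_comm (L b)]
    rw [hp', mul_smul_comm, this]
  have pp : IsIdempotentElem p := by
    change p * p = p
    nth_rw 1 [hp]
    rw [smul_mul_assoc, add_mul, add_mul, add_mul, one_mul, ap, bp, ← Lmul, mul_assoc, ap, bp]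
    module
  have qq : IsIdempotentElem q := by
    change q * q = q
    rw [hq, smul_mul_smul_comm, sub_mul, mul_sub, mul_sub, Lc, one_mul, mul_one, one_mul]
    module
  have trp := (LinearMap.isProj_range_iff_isIdempotentElem p).2 pp |>.trace
  have trq := (LinearMap.isProj_range_iff_isIdempotentElem q).2 qq |>.trace
  rw [hp, map_smul, map_add, map_add, map_add, tr1, trL, trL, trL, ← hp] at trp
  rw [hq, map_smul, map_sub, tr1, trL, ← hq] at trq
  have hker := q.finrank_range_add_finrank_ker
  have hdim := Submodule.finrank_sup_add_finrank_inf_eq (LinearMap.range p) (LinearMap.ker q)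
  have hle := Submodule.finrank_le (LinearMap.range p ⊔ LinearMap.ker q)
  -- A function fixed by `a`, `b` and `c` is constant, by transitivity.
  have hinf : Module.finrank ℚ ↥(LinearMap.range p ⊓ LinearMap.ker q) ≤ 1 := by
    refine (Submodule.finrank_mono (t := Submodule.span ℚ {(1 : X → ℚ)}) ?_).trans
      ((finrank_span_le_card _).trans (by simp))
    rintro f ⟨⟨g, rfl⟩, hf⟩
    have fa : L a (p g) = p g := LinearMap.congr_fun ap g
    have fb : L b (p g) = p g := LinearMap.congr_fun bp g
    have fc : L c (p g) = p g := by
      have : (1 / 2 : ℚ) • (p g - L c (p g)) = 0 := hf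
      exact (sub_eq_zero.1 ((smul_eq_zero.1 this).resolve_left (by norm_num))).symm
    have hinv : ∀ σ ∈ Subgroup.closure {a, b, c}, ∀ x, p g (σ x) = p g x := by
      intro σ hσ
      induction hσ using Subgroup.closure_induction with
      | mem σ h =>
        rcases h with rfl | rfl | rfl
        exacts [congrFun fa, congrFun fb, congrFun fc]
      | one => exact fun x => rfl
      | mul σ τ _ _ h₁ h₂ => exact fun x => (h₁ (τ x)).trans (h₂ x)
      | inv σ _ h => exact fun x => by rw [← h, ← Perm.mul_apply, mul_inv_cancel, Perm.one_apply]
    rw [Submodule.mem_span_singleton]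
    rcases isEmpty_or_nonempty X with hX | ⟨⟨x⟩⟩
    · exact ⟨0, Subsingleton.elim _ _⟩
    · refine ⟨p g x, funext fun y => ?_⟩
      obtain ⟨σ, hσ, rfl⟩ := htrans x y
      simp [hinv σ hσ]
  rw [Module.finrank_fintype_fun_eq_card] at hker hle
  have h : Module.finrank ℚ (LinearMap.range p) ≤ Module.finrank ℚ (LinearMap.range q) + 1 := by
    omega
  have h' : (Module.finrank ℚ (LinearMap.range p) : ℚ) ≤
    Module.finrank ℚ (LinearMap.range q) + 1 := by exact_mod_cast h
  rw [← trp, ← trq, smul_eq_mul, smul_eq_mul] at h'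
  have : ((Finset.univ.filter fun x => a x = x).card +
      (Finset.univ.filter fun x => b x = x).card +
      (Finset.univ.filter fun x => (a * b) x = x).card +
      2 * (Finset.univ.filter fun x => c x = x).card : ℚ) ≤ Fintype.card X + 4 := by linarith
  exact_mod_cast this

/-! ### Classes of involutions in S₆ -/

/-- All nontrivial cycles have length 2, so the size of the support determines the cycle type. -/
lemma isConj_of_card_support_eq {α : Type*} [Fintype α] [DecidableEq α] {p q : Perm α}
    (hp : p * p = 1) (hq : q * q = 1) (h : p.support.card = q.support.card) : IsConj p q := by
  have key : ∀ r : Perm α, r * r = 1 →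
      r.cycleType = Multiset.replicate (Multiset.card r.cycleType) 2 ∧
        r.support.card = Multiset.card r.cycleType * 2 := fun r hr => by
    have h := Perm.cycleType_of_pow_prime_eq_one (p := 2) (σ := r) (by rw [sq, hr])
    have h' := r.sum_cycleType
    rw [h, Multiset.sum_replicate, smul_eq_mul] at h'
    exact ⟨h, h'.symm⟩
  rw [Perm.isConj_iff_cycleType_eq, (key p hp).1, (key q hq).1]
  congr 1
  have := (key p hp).2
  have := (key q hq).2
  omega

/-- The involutions of `S₆` that move exactly `k` points. -/
def InvolutionClass (k : ℕ) : Type :=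
  {p : Perm (Fin 6) // p * p = 1 ∧ p.support.card = k}

instance (k : ℕ) : DecidableEq (InvolutionClass k) :=
  inferInstanceAs (DecidableEq {p : Perm (Fin 6) // p * p = 1 ∧ p.support.card = k})

instance (k : ℕ) : Fintype (InvolutionClass k) :=
  inferInstanceAs (Fintype {p : Perm (Fin 6) // p * p = 1 ∧ p.support.card = k})

/-- The action of `S₆` by conjugation on a class of involutions. -/
def conjInvolution (k : ℕ) : Perm (Fin 6) →* Perm (InvolutionClass k) :=
  MonoidHom.toHomPerm
    { toFun := fun g p => ⟨g * p.1 * g⁻¹, by rw [conj_mul, p.2.1, mul_one, mul_inv_cancel],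
        by rw [Perm.card_support_conj, p.2.2]⟩
      map_one' := funext fun p => Subtype.ext (by
        change 1 * p.1 * 1⁻¹ = p.1; simp)
      map_mul' := fun g h => funext fun p => Subtype.ext (by
        change g * h * p.1 * (g * h)⁻¹ = g * (h * p.1 * h⁻¹) * g⁻¹; group) }

/-- The number of points of `InvolutionClass k` that are fixed by `g`. -/
def numFixed (k : ℕ) (g : Perm (Fin 6)) : ℕ :=
  (Finset.univ.filter fun x => conjInvolution k g x = x).card

lemma numFixed_eq_of_isConj (k : ℕ) {g h : Perm (Fin 6)} (hgh : IsConj g h) :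
    numFixed k g = numFixed k h := by
  obtain ⟨c, rfl⟩ := isConj_iff.1 hgh
  refine Finset.card_equiv (conjInvolution k c) fun x => ?_
  simp [map_mul, Perm.mul_apply]

lemma card_involutionClass {k : ℕ} (hk : k = 2 ∨ k = 6) :
    Fintype.card (InvolutionClass k) = 15 := by
  rcases hk with rfl | rfl <;> decide +kernel

/-- Fixed-point counts are class functions, so one representative per class is evaluated. The values
agree for both `k` because an outer automorphism of `S₆` interchanges the two odd classes concerned.
-/
lemma numFixed_of_card_support {k : ℕ} (hk : k = 2 ∨ k = 6) {g : Perm (Fin 6)} (hg : g * g = 1) :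
    (g.support.card = k → numFixed k g = 7) ∧ (g.support.card = 4 → numFixed k g = 3) := by
  have h₂ : numFixed 2 (swap 0 1) = 7 := by decide +kernel
  have h₂₄ : numFixed 2 (swap 0 1 * swap 2 3) = 3 := by decide +kernel
  have h₆ : numFixed 6 (swap 0 1 * swap 2 3 * swap 4 5) = 7 := by decide +kernel
  have h₆₄ : numFixed 6 (swap 0 1 * swap 2 3) = 3 := by decide +kernel
  have key : ∀ p : Perm (Fin 6), p * p = 1 → g.support.card = p.support.card →
      numFixed k g = numFixed k p :=
    fun p hp h => numFixed_eq_of_isConj k (isConj_of_card_support_eq hg hp h)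
  rcases hk with rfl | rfl
  · exact ⟨fun h => (key _ (by decide) (h.trans (by decide))).trans h₂,
      fun h => (key _ (by decide) (h.trans (by decide))).trans h₂₄⟩
  · exact ⟨fun h => (key _ (by decide) (h.trans (by decide))).trans h₆,
      fun h => (key _ (by decide) (h.trans (by decide))).trans h₆₄⟩

lemma sign_of_card_support {g : Perm (Fin 6)} (hg : g * g = 1) :
    (g.support.card = 2 → Perm.sign g = -1) ∧ (g.support.card = 4 → Perm.sign g = 1) ∧
      (g.support.card = 6 → Perm.sign g = -1) := by
  have key : ∀ p : Perm (Fin 6), p * p = 1 → g.support.card = p.support.card →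
      Perm.sign g = Perm.sign p := fun p hp h =>
    isConj_iff_eq.1 (Perm.sign.map_isConj (isConj_of_card_support_eq hg hp h))
  refine ⟨fun h => ?_, fun h => ?_, fun h => ?_⟩
  · exact (key (swap 0 1) (by decide) (h.trans (by decide))).trans (by decide)
  · exact (key (swap 0 1 * swap 2 3) (by decide) (h.trans (by decide))).trans (by decide)
  · exact (key (swap 0 1 * swap 2 3 * swap 4 5) (by decide) (h.trans (by decide))).trans
      (by decide)

lemma card_support_of_orderOf_eq_two {g : Perm (Fin 6)} (hg : orderOf g = 2) :
    g.support.card = 2 ∨ g.support.card = 4 ∨ g.support.card = 6 := by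
  obtain ⟨n, hn⟩ := Perm.cycleType_prime_order (hg ▸ Nat.prime_two)
  have h := g.sum_cycleType
  rw [hn, hg, Multiset.sum_replicate, smul_eq_mul] at h
  have := g.support.card_le_univ
  rw [Fintype.card_fin] at this
  omega

/-- Generators of `S₆` are not all even. -/
lemma not_all_even {a b c : Perm (Fin 6)} (hgen : Subgroup.closure {a, b, c} = ⊤)
    (ha : Perm.sign a = 1) (hb : Perm.sign b = 1) (hc : Perm.sign c = 1) : False := by
  have : Subgroup.closure {a, b, c} ≤ Perm.sign.ker := by
    rw [Subgroup.closure_le]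
    rintro x (rfl | rfl | rfl) <;> assumption
  rw [hgen] at this
  have h : Perm.sign (swap (0 : Fin 6) 1) = 1 := this (Subgroup.mem_top _)
  exact absurd h (by decide)

/-- A triangle-point generating triple of `S₆` does not consist of even involutions and
involutions of one class of odd ones. -/
lemma not_generate_of_card_support {k : ℕ} (hk : k = 2 ∨ k = 6) {a b c : Perm (Fin 6)}
    (ha : a * a = 1) (hb : b * b = 1) (hc : c * c = 1) (hab : a * b * (a * b) = 1)
    (hgen : Subgroup.closure {a, b, c} = ⊤)
    (ka : a.support.card = k ∨ a.support.card = 4) (kb : b.support.card = k ∨ b.support.card = 4)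
    (kc : c.support.card = k ∨ c.support.card = 4)
    (kab : (a * b).support.card = k ∨ (a * b).support.card = 4) : False := by
  have hcomm : Commute a b := by
    rw [Commute, SemiconjBy, mul_eq_one_iff_eq_inv.1 hab, mul_inv_rev,
      ← mul_eq_one_iff_eq_inv.1 ha, ← mul_eq_one_iff_eq_inv.1 hb]
  have hsq : ∀ g : Perm (Fin 6), g * g = 1 → conjInvolution k g * conjInvolution k g = 1 :=
    fun g hg => by rw [← map_mul, hg, map_one]
  have hle := card_fixed_le_of_transitive (hsq a ha) (hsq b hb) (hsq c hc)
    (hcomm.map (conjInvolution k)) (fun x y => by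
      obtain ⟨g, hg⟩ := isConj_iff.1
        (isConj_of_card_support_eq x.2.1 y.2.1 (x.2.2.trans y.2.2.symm))
      refine ⟨conjInvolution k g, ?_, Subtype.ext hg⟩
      have := Subgroup.mem_map_of_mem (conjInvolution k) (hgen ▸ Subgroup.mem_top g)
      rwa [MonoidHom.map_closure, Set.image_insert_eq, Set.image_pair] at this)
  rw [← map_mul, card_involutionClass hk] at hle
  change numFixed k a + numFixed k b + numFixed k (a * b) + 2 * numFixed k c ≤ 15 + 4 at hle
  have hsign : ∀ g : Perm (Fin 6), g * g = 1 → (g.support.card = k → Perm.sign g = -1) ∧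
      (g.support.card = 4 → Perm.sign g = 1) := fun g hg => by
    obtain ⟨h₂, h₄, h₆⟩ := sign_of_card_support hg
    rcases hk with rfl | rfl
    exacts [⟨h₂, h₄⟩, ⟨h₆, h₄⟩]
  have key : ∀ g : Perm (Fin 6), g * g = 1 → (g.support.card = k ∨ g.support.card = 4) →
      (numFixed k g = 7 ∧ Perm.sign g = -1) ∨ (numFixed k g = 3 ∧ Perm.sign g = 1) :=
    fun g hg h => h.imp
      (fun h => ⟨(numFixed_of_card_support hk hg).1 h, (hsign g hg).1 h⟩)
      (fun h => ⟨(numFixed_of_card_support hk hg).2 h, (hsign g hg).2 h⟩)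
  have hmul := Perm.sign_mul a b
  -- By signs, either two of `a, b, ab` are odd, and the left side of `hle` is at least 7 + 7 + 3 +
  -- 2·3 = 23, or all three are even. In the latter case `c` must be odd, and the left side is 3 + 3
  -- + 3 + 2·7 = 23. Both exceed 19.
  rcases key a ha ka with ⟨fa, sa⟩ | ⟨fa, sa⟩ <;> rcases key b hb kb with ⟨fb, sb⟩ | ⟨fb, sb⟩ <;>
    rcases key _ hab kab with ⟨fab, sab⟩ | ⟨fab, sab⟩ <;>
    rcases key c hc kc with ⟨fc, sc⟩ | ⟨fc, sc⟩ <;>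
    first
    | omega
    | exact not_all_even hgen sa sb sc
    | (rw [sa, sb, sab] at hmul; exact absurd hmul (by decide))

/-- A triangle-point generating triple of `S₆` meets all the classes of involutions. -/
lemma exists_card_support_eq {a b c : Perm (Fin 6)} (ha : orderOf a = 2) (hb : orderOf b = 2)
    (hc : orderOf c = 2) (hab : orderOf (a * b) = 2) (hgen : Subgroup.closure {a, b, c} = ⊤)
    {k : ℕ} (hk : k = 2 ∨ k = 4 ∨ k = 6) :
    a.support.card = k ∨ b.support.card = k ∨ c.support.card = k ∨ (a * b).support.card = k := by
  have sq' : ∀ g : Perm (Fin 6), orderOf g = 2 → g * g = 1 := fun g hg => by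
    rw [← sq, ← hg, pow_orderOf_eq_one]
  have ka := card_support_of_orderOf_eq_two ha
  have kb := card_support_of_orderOf_eq_two hb
  have kc := card_support_of_orderOf_eq_two hc
  have kab := card_support_of_orderOf_eq_two hab
  by_contra! hne
  obtain ⟨na, nb, nc, nab⟩ := hne
  rcases hk with rfl | rfl | rfl
  · exact not_generate_of_card_support (.inr rfl) (sq' a ha) (sq' b hb) (sq' c hc) (sq' _ hab) hgen
      (by omega) (by omega) (by omega) (by omega)
  -- Without the even class, `a`, `b` and `ab` would all be odd.
  · have odd : ∀ g : Perm (Fin 6), g * g = 1 →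
        (g.support.card = 2 ∨ g.support.card = 4 ∨ g.support.card = 6) → g.support.card ≠ 4 →
        Perm.sign g = -1 := fun g hg h h' => by
      obtain ⟨h₂, -, h₆⟩ := sign_of_card_support hg
      rcases h with h | h | h
      exacts [h₂ h, absurd h h', h₆ h]
    have := Perm.sign_mul a b
    rw [odd _ (sq' a ha) ka na, odd _ (sq' b hb) kb nb, odd _ (sq' _ hab) kab nab] at this
    exact absurd this (by decide)
  · exact not_generate_of_card_support (.inl rfl) (sq' a ha) (sq' b hb) (sq' c hc) (sq' _ hab) hgen
      (by omega) (by omega) (by omega) (by omega)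

end Involutions

/-! ### The main theorem -/

theorem mainTheorem7 {G : Type*} [Group G] (a b c : G) (hG : IsTrianglePoint a b c)
    (hS₆ : Nonempty (G ≃* Equiv.Perm (Fin 6))) (T : Set G)
    (ha : a ∈ T) (hb : b ∈ T) (hc : c ∈ T) (hab : a * b ∈ T)
    (V : Type*) [NonUnitalNonAssocCommRing V] [Module ℝ V]
    [IsScalarTower ℝ V V] [SMulCommClass ℝ V V] :
    IsEmpty (MajoranaRepresentation G T V) := by
  refine ⟨fun R => ?_⟩
  obtain ⟨e⟩ := hS₆
  have ord : ∀ x : G, orderOf x = 2 → orderOf (e x) = 2 := fun x hx => by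
    rw [MulEquiv.orderOf_eq, hx]
  have hgen : Subgroup.closure {e a, e b, e c} = ⊤ := by
    have := congrArg (Subgroup.map e.toMonoidHom) hG.generate
    rw [MonoidHom.map_closure, Set.image_insert_eq, Set.image_pair,
      Subgroup.map_top_of_surjective _ e.surjective] at this
    exact this
  have hT : ∀ x ∈ T, ∀ p : Equiv.Perm (Fin 6), p * p = 1 →
      (e x).support.card = p.support.card → e.symm p ∈ T := fun x hx p hp h => by
    have hx' : e x * e x = 1 := by
      rw [← sq, ← ord x (R.involution x hx), pow_orderOf_eq_one]
    obtain ⟨g, hg⟩ := isConj_iff.1 (isConj_of_card_support_eq hx' hp h)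
    have := R.conj_mem (e.symm g) x hx
    rwa [← hg, map_mul, map_mul, map_inv, e.symm_apply_apply]
  -- Since `T` is closed under conjugation, meeting every class of involutions means containing them
  -- all.
  have mem : ∀ p : Equiv.Perm (Fin 6), p * p = 1 →
      (p.support.card = 2 ∨ p.support.card = 4 ∨ p.support.card = 6) → e.symm p ∈ T := by
    intro p hp hk
    rcases exists_card_support_eq (ord a hG.orderOf_a) (ord b hG.orderOf_b) (ord c hG.orderOf_c)
      (by rw [← map_mul]; exact ord _ hG.orderOf_ab) hgen hk with h | h | h | h
    exacts [hT a ha p hp h, hT b hb p hp h, hT c hc p hp h,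
      hT _ hab p hp (by rw [map_mul]; exact h)]
  have comm : Commute (Equiv.swap (0 : Fin 6) 1) (Equiv.swap 2 3) := by
    rw [Commute, SemiconjBy]; decide
  refine R.false_of_commute (t := e.symm (.swap 0 1)) (s := e.symm (.swap 2 3))
    (r := e.symm (.swap 4 5)) (comm.map e.symm) ?_ ?_ ?_ ?_ ?_ ?_ ?_
  all_goals
    try simp only [← map_mul]
    exact mem _ (by decide) (by decide)
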